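/- Let $G$ be a finite group. A stem extension of $G$ is a short exact sequence of groups $1\to N\xrightarrow{\iota}\hat G\xrightarrow{\pi} G\to 1$ with $\iota(N)\subseteq Z(\hat G)\cap \hat G'$, and a Schur cover of $G$ is a stem extension for which the order of $\hat G$ is maximal among all stem extensions of $G$. The deep commuting graph $\Delta_D(G)$, formed with a Schur cover $\pi:\tilde G\to G$, is the simple graph with vertex set $G$ in which two distinct elements $x,y\in G$ are adjacent if and only if their preimages under $\pi$ commute in $\tilde G$. Then $G$ has a Schur cover, and, for every choice of the Schur cover, $\Delta_D(G)$ is complete if and only if $G$ is cyclic. -/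

import Mathlib

universe u v

namespace GroupExtension

/-- An extension `1 → N → E → G → 1` is central if the image of `N` lies in the centre of `E`. -/
def IsCentral {N E : Type v} {G : Type u} [Group N] [Group E] [Group G]
    (S : GroupExtension N E G) : Prop :=
  S.inl.range ≤ Subgroup.center E

/-- A stem extension: the image of `N` lies in the centre and in the derived subgroup of `E`. -/
def IsStem {N E : Type v} {G : Type u} [Group N] [Group E] [Group G]
    (S : GroupExtension N E G) : Prop :=
  S.IsCentral ∧ S.inl.range ≤ commutator E

/-- A Schur cover of `G`: a stem extension of `G` of maximal order. The order is taken in `ℕ∞`,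
so that no infinite group is given a spurious finite order. -/
def IsSchurCover {N E : Type v} {G : Type u} [Group N] [Group E] [Group G]
    (S : GroupExtension N E G) : Prop :=
  S.IsStem ∧
    ∀ (N' E' : Type v) [Group N'] [Group E'] (S' : GroupExtension N' E' G),
      S'.IsStem → ENat.card E' ≤ ENat.card E

/-- The deep commuting graph of `G`, read off from an extension `S` of `G` (to be used with `S` a
Schur cover): the vertices are the elements of `G`, and distinct `x`, `y` are adjacent if their
preimages commute. -/
def deepCommutingGraph {N E : Type v} {G : Type u} [Group N] [Group E] [Group G]
    (S : GroupExtension N E G) : SimpleGraph G where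
  Adj x y := x ≠ y ∧ ∀ a b : E, S.rightHom a = x → S.rightHom b = y → Commute a b
  symm := ⟨fun _ _ h => ⟨h.1.symm, fun a b ha hb => (h.2 b a hb ha).symm⟩⟩
  loopless := ⟨fun _ h => h.1 rfl⟩

end GroupExtension

/-!
In a central extension `E` of a finite group `G`, the commutator `⁅a, b⁆` depends only on the images
of `a` and `b` in `G`. Hence `E` has at most `|G|²` commutators, so Schur's theorem bounds its
derived subgroup, and with it the kernel of a stem extension, in terms of `|G|` alone; a stem
extension of maximal order therefore exists.

The deep commuting graph is complete exactly when the Schur cover `E` is abelian. If `G` is cyclic,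
then `E` is abelian, being central over a cyclic group. Conversely, if `E` is abelian, then its
derived subgroup is trivial, so `E ≃ G` and every stem extension of `G` has order at most `|G|`.
But an abelian `G` which is not cyclic maps onto `(ℤ/d)²` for some `d > 1`, and the Heisenberg group
of the pullback to `G` of the pairing `(x, y) ↦ x₁ y₂` on `(ℤ/d)²` is a stem extension of `G` of
order `d |G|`: its commutator form is the determinant `x₁ y₂ - y₁ x₂`, which attains every value.
-/

open scoped commutatorElement

section CentralKernel

variable {E G : Type*} [Group E] [Group G] {f : E →* G}

theorem commutatorElement_mul_left_of_mem_center {z : E} (hz : z ∈ Subgroup.center E) (x y : E) :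
    ⁅x * z, y⁆ = ⁅x, y⁆ := by
  have hzy : Commute z y := (Subgroup.mem_center_iff.mp hz y).symm
  rw [commutatorElement_mul_left_eq_conj_mul, commutatorElement_eq_one_iff_commute.mpr hzy,
    mul_one, mul_inv_cancel, one_mul]

theorem commutatorElement_congr_left_of_ker_le_center (hf : f.ker ≤ Subgroup.center E) {x x' : E}
    (hx : f x = f x') (y : E) : ⁅x, y⁆ = ⁅x', y⁆ := by
  have hz : x'⁻¹ * x ∈ Subgroup.center E := hf (by rw [MonoidHom.mem_ker, map_mul, map_inv, hx,
    inv_mul_cancel])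
  simpa only [mul_inv_cancel_left] using commutatorElement_mul_left_of_mem_center hz x' y

theorem commutatorElement_congr_of_ker_le_center (hf : f.ker ≤ Subgroup.center E)
    {x x' y y' : E} (hx : f x = f x') (hy : f y = f y') : ⁅x, y⁆ = ⁅x', y'⁆ := by
  rw [commutatorElement_congr_left_of_ker_le_center hf hx, ← commutatorElement_inv y,
    commutatorElement_congr_left_of_ker_le_center hf hy, commutatorElement_inv]

theorem exists_injective_commutatorSet_prod (hf : f.ker ≤ Subgroup.center E) :
    ∃ F : commutatorSet E → G × G, Function.Injective F := by
  choose x y hxy using fun c : commutatorSet E => c.2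
  refine ⟨fun c => (f (x c), f (y c)), fun c c' h => Subtype.ext ?_⟩
  rw [Prod.mk.injEq] at h
  rw [← hxy c, ← hxy c', commutatorElement_congr_of_ker_le_center hf h.1 h.2]

theorem monotone_cardCommutatorBound : Monotone Subgroup.cardCommutatorBound := by
  intro m n hmn
  have one_le_bound (k : ℕ) : 1 ≤ Subgroup.cardCommutatorBound k := by
    rcases k.eq_zero_or_pos with rfl | hk
    · simp [Subgroup.cardCommutatorBound]
    · exact Nat.one_le_pow _ _ (Nat.pow_pos hk)
  rcases m.eq_zero_or_pos with rfl | hm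
  · exact one_le_bound n
  · have hn : 1 ≤ n := hm.trans_le hmn
    unfold Subgroup.cardCommutatorBound
    gcongr
    exact Nat.one_le_pow _ _ hn

theorem finite_commutator_of_ker_le_center [Finite G] (hf : f.ker ≤ Subgroup.center E) :
    Finite (commutator E) := by
  obtain ⟨F, hF⟩ := exists_injective_commutatorSet_prod hf
  have : Finite (commutatorSet E) := Finite.of_injective F hF
  infer_instance

theorem card_commutator_le_of_ker_le_center [Finite G] (hf : f.ker ≤ Subgroup.center E) :
    Nat.card (commutator E) ≤ Subgroup.cardCommutatorBound (Nat.card (G × G)) := by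
  obtain ⟨F, hF⟩ := exists_injective_commutatorSet_prod hf
  have : Finite (commutatorSet E) := Finite.of_injective F hF
  exact (Subgroup.card_commutator_le_of_finite_commutatorSet E).trans
    (monotone_cardCommutatorBound (Nat.card_le_card_of_injective F hF))

end CentralKernel

section Extension

variable {N E G H : Type*} [Group N] [Group E] [Group G] [Group H]

theorem card_eq_card_mul_card_of_groupExtension (S : GroupExtension N E G) :
    Nat.card E = Nat.card G * Nat.card N := by
  rw [Subgroup.card_eq_card_quotient_mul_card_subgroup S.inl.range,
    Nat.card_congr S.quotientRangeInlEquivRight.toEquiv,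
    Nat.card_congr (MonoidHom.ofInjective S.inl_injective).toEquiv]

theorem finite_of_groupExtension [Finite N] [Finite G] (S : GroupExtension N E G) : Finite E := by
  refine Nat.finite_of_card_ne_zero ?_
  rw [card_eq_card_mul_card_of_groupExtension S]
  exact mul_ne_zero Finite.card_pos.ne' Finite.card_pos.ne'

/-- The extension `1 → N → E → H → 1` obtained from `1 → N → E → G → 1` by identifying `G` with
`H`. It moves quotients between universes. -/
def groupExtensionCongrRight (S : GroupExtension N E G) (e : G ≃* H) : GroupExtension N E H where
  inl := S.inl
  rightHom := e.toMonoidHom.comp S.rightHom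
  inl_injective := S.inl_injective
  range_inl_eq_ker_rightHom :=
    S.range_inl_eq_ker_rightHom.trans (MonoidHom.ker_mulEquiv_comp S.rightHom e).symm
  rightHom_surjective := e.surjective.comp S.rightHom_surjective

variable (E) in
/-- The extension `1 → 1 → E → E → 1`, the smallest stem extension of `E`. -/
def trivialGroupExtension : GroupExtension PUnit E E where
  inl := 1
  rightHom := MonoidHom.id E
  inl_injective := Function.injective_of_subsingleton _
  range_inl_eq_ker_rightHom := by rw [MonoidHom.range_one, MonoidHom.ker_id]
  rightHom_surjective := Function.surjective_id

end Extension

section Stem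

variable {N E : Type v} {G : Type u} [Group N] [Group E] [Group G] {S : GroupExtension N E G}

theorem ker_rightHom_le_center (hS : S.IsCentral) : S.rightHom.ker ≤ Subgroup.center E :=
  S.range_inl_eq_ker_rightHom.symm.trans_le hS

theorem deepCommutingGraph_eq_top_iff_isMulCommutative (hS : S.IsCentral) :
    S.deepCommutingGraph = ⊤ ↔ IsMulCommutative E := by
  rw [isMulCommutative_iff]
  constructor
  · intro hcomplete a b
    by_cases hab : S.rightHom a = S.rightHom b
    · rw [← commutatorElement_eq_one_iff_mul_comm, commutatorElement_congr_of_ker_le_center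
        (ker_rightHom_le_center hS) hab rfl, commutatorElement_self]
    · have hadj : S.deepCommutingGraph.Adj (S.rightHom a) (S.rightHom b) := by
        rwa [hcomplete, SimpleGraph.top_adj]
      exact hadj.2 a b rfl rfl
  · intro hcomm
    ext x y
    exact ⟨fun hxy => hxy.1, fun hxy => ⟨hxy, fun a b _ _ => hcomm a b⟩⟩

theorem rightHom_injective_of_isStem [IsMulCommutative E] (hS : S.IsStem) :
    Function.Injective S.rightHom := by
  have hcommutator : commutator E ≤ ⊥ := Subgroup.commutator_le.mpr fun a _ b _ =>
    commutatorElement_eq_one_iff_mul_comm.mpr (mul_comm' a b)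
  rw [← MonoidHom.ker_eq_bot_iff, ← S.range_inl_eq_ker_rightHom, eq_bot_iff]
  exact hS.2.trans hcommutator

theorem injective_inclusion_commutator_of_isStem (hS : S.IsStem) :
    Function.Injective fun n : N => (⟨S.inl n, hS.2 ⟨n, rfl⟩⟩ : commutator E) :=
  fun _ _ h => S.inl_injective (congrArg Subtype.val h)

theorem finite_of_isStem [Finite G] (hS : S.IsStem) : Finite E := by
  have := finite_commutator_of_ker_le_center (ker_rightHom_le_center hS.1)
  have : Finite N := Finite.of_injective _ (injective_inclusion_commutator_of_isStem hS)
  exact finite_of_groupExtension S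

theorem card_le_of_isStem [Finite G] (hS : S.IsStem) :
    Nat.card E ≤ Nat.card G * Subgroup.cardCommutatorBound (Nat.card (G × G)) := by
  have hker := ker_rightHom_le_center hS.1
  have := finite_commutator_of_ker_le_center hker
  calc
    Nat.card E = Nat.card G * Nat.card N := card_eq_card_mul_card_of_groupExtension S
    _ ≤ Nat.card G * Nat.card (commutator E) := by
      gcongr
      exact Nat.card_le_card_of_injective _ (injective_inclusion_commutator_of_isStem hS)
    _ ≤ Nat.card G * Subgroup.cardCommutatorBound (Nat.card (G × G)) := by
      gcongr
      exact card_commutator_le_of_ker_le_center hker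

theorem isStem_trivialGroupExtension (E : Type u) [Group E] :
    (trivialGroupExtension E).IsStem := by
  simp [GroupExtension.IsStem, GroupExtension.IsCentral, trivialGroupExtension]

theorem isStem_groupExtensionCongrRight_iff {H : Type*} [Group H] (e : G ≃* H) :
    (groupExtensionCongrRight S e).IsStem ↔ S.IsStem :=
  Iff.rfl

theorem exists_isStem (G : Type u) [Group G] [Small.{v} G] :
    ∃ (N E : Type v) (_ : Group N) (_ : Group E) (S : GroupExtension N E G), S.IsStem :=
  ⟨PUnit, Shrink.{v} G, inferInstance, inferInstance,
    groupExtensionCongrRight (trivialGroupExtension (Shrink.{v} G)) Shrink.mulEquiv,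
    (isStem_groupExtensionCongrRight_iff _).mpr (isStem_trivialGroupExtension _)⟩

theorem exists_isSchurCover (G : Type u) [Group G] [Finite G] :
    ∃ (N E : Type v) (_ : Group N) (_ : Group E) (S : GroupExtension N E G), S.IsSchurCover := by
  let stemOrders : Set ℕ := {k | ∃ (N E : Type v) (_ : Group N) (_ : Group E)
    (S : GroupExtension N E G), S.IsStem ∧ Nat.card E = k}
  have hnonempty : stemOrders.Nonempty := by
    obtain ⟨N, E, _, _, S, hS⟩ := exists_isStem.{u, v} G
    exact ⟨_, N, E, _, _, S, hS, rfl⟩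
  have hbdd : BddAbove stemOrders := by
    refine ⟨Nat.card G * Subgroup.cardCommutatorBound (Nat.card (G × G)), ?_⟩
    rintro _ ⟨N, E, _, _, S, hS, rfl⟩
    exact card_le_of_isStem hS
  obtain ⟨N, E, _, _, S, hS, hcard⟩ := Nat.sSup_mem hnonempty hbdd
  refine ⟨N, E, _, _, S, hS, fun N' E' _ _ S' hS' => ?_⟩
  have := finite_of_isStem hS
  have := finite_of_isStem hS'
  rw [ENat.card_eq_coe_natCard, ENat.card_eq_coe_natCard, Nat.cast_le, hcard]
  exact le_csSup hbdd ⟨N', E', _, _, S', hS', rfl⟩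

end Stem

/-- The Heisenberg group of a bimultiplicative map `f : A × A → M`: the central extension of `A`
by `M` with cocycle `f`, realised on `A × M`. The map is curried, so that bimultiplicativity is
part of its type. -/
@[ext]
structure HeisenbergGroup {A M : Type*} [Group A] [CommGroup M] (f : A →* A →* M) where
  base : A
  fiber : M

namespace HeisenbergGroup

section Group

variable {A M : Type*} [Group A] [CommGroup M] {f : A →* A →* M}

instance : Mul (HeisenbergGroup f) :=
  ⟨fun x y => ⟨x.base * y.base, x.fiber * y.fiber * f x.base y.base⟩⟩

instance : One (HeisenbergGroup f) := ⟨⟨1, 1⟩⟩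

instance : Inv (HeisenbergGroup f) := ⟨fun x => ⟨x.base⁻¹, x.fiber⁻¹ * f x.base x.base⟩⟩

@[simp]
theorem base_mul (x y : HeisenbergGroup f) : (x * y).base = x.base * y.base := rfl

@[simp]
theorem fiber_mul (x y : HeisenbergGroup f) :
    (x * y).fiber = x.fiber * y.fiber * f x.base y.base := rfl

@[simp]
theorem base_one : (1 : HeisenbergGroup f).base = 1 := rfl

@[simp]
theorem fiber_one : (1 : HeisenbergGroup f).fiber = 1 := rfl

@[simp]
theorem base_inv (x : HeisenbergGroup f) : x⁻¹.base = x.base⁻¹ := rfl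

@[simp]
theorem fiber_inv (x : HeisenbergGroup f) : x⁻¹.fiber = x.fiber⁻¹ * f x.base x.base := rfl

instance : Group (HeisenbergGroup f) :=
  Group.ofLeftAxioms
    (fun x y z => by
      ext
      · exact mul_assoc _ _ _
      · simp only [fiber_mul, base_mul, map_mul, MonoidHom.mul_apply, mul_assoc, mul_left_comm,
          mul_comm])
    (fun x => by ext <;> simp)
    (fun x => by ext <;> simp)

variable (f) in
/-- The Heisenberg group of `f : A →* A →* M` as an extension of `A` by `M`. -/
def extension : GroupExtension M (HeisenbergGroup f) A where
  inl :=
    { toFun := fun m => ⟨1, m⟩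
      map_one' := rfl
      map_mul' := fun m n => by ext <;> simp }
  rightHom :=
    { toFun := base
      map_one' := rfl
      map_mul' := fun _ _ => rfl }
  inl_injective := fun _ _ h => congrArg fiber h
  range_inl_eq_ker_rightHom := by
    ext x
    exact ⟨by rintro ⟨m, rfl⟩; rfl, fun hx => ⟨x.fiber, HeisenbergGroup.ext (Eq.symm hx) rfl⟩⟩
  rightHom_surjective := fun x => ⟨⟨x, 1⟩, rfl⟩

theorem mul_inl_comm (m : M) (x : HeisenbergGroup f) :
    x * (extension f).inl m = (extension f).inl m * x := by
  ext <;> simp [extension, mul_comm]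

end Group

theorem inl_div_eq_commutatorElement {A M : Type*} [CommGroup A] [CommGroup M] (f : A →* A →* M)
    (x y : A) : (extension f).inl (f x y / f y x) =
      ⁅(⟨x, 1⟩ : HeisenbergGroup f), (⟨y, 1⟩ : HeisenbergGroup f)⁆ := by
  rw [commutatorElement_def, eq_mul_inv_iff_mul_eq, eq_mul_inv_iff_mul_eq]
  ext
  · simp [extension, mul_comm]
  · simp [extension]

theorem isCentral_extension {A M : Type v} [Group A] [CommGroup M] (f : A →* A →* M) :
    (extension f).IsCentral := by
  rintro _ ⟨m, rfl⟩
  exact Subgroup.mem_center_iff.mpr (mul_inl_comm m)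

theorem isStem_extension {A M : Type v} [CommGroup A] [CommGroup M] {f : A →* A →* M}
    (hf : Subgroup.closure {m | ∃ x y, f x y / f y x = m} = ⊤) : (extension f).IsStem := by
  refine ⟨isCentral_extension f, ?_⟩
  rw [MonoidHom.range_eq_map, ← hf, MonoidHom.map_closure, Subgroup.closure_le]
  rintro _ ⟨_, ⟨x, y, rfl⟩, rfl⟩
  rw [inl_div_eq_commutatorElement]
  exact Subgroup.commutator_mem_commutator (Subgroup.mem_top _) (Subgroup.mem_top _)

end HeisenbergGroup

section NonCyclic

theorem isCyclic_pi_zmod_of_pairwise_coprime {ι : Type*} [Finite ι] {n : ι → ℕ}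
    (hn : Pairwise (Function.onFun Nat.Coprime n)) :
    IsCyclic (∀ i, Multiplicative (ZMod (n i))) := by
  have := Fintype.ofFinite ι
  let e : Multiplicative (ZMod (∏ i, n i)) ≃* ∀ i, Multiplicative (ZMod (n i)) :=
    (ZMod.prodEquivPi n hn).toAddEquiv.toMultiplicative.trans (MulEquiv.piMultiplicative _)
  exact e.isCyclic.mp inferInstance

theorem surjective_evalMonoidHom_prod_evalMonoidHom {ι : Type*} {X : ι → Type*}
    [∀ k, MulOneClass (X k)] {i j : ι} (hij : i ≠ j) :
    Function.Surjective ((Pi.evalMonoidHom X i).prod (Pi.evalMonoidHom X j)) := by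
  classical
  exact fun ⟨r, s⟩ => ⟨Function.update (Function.update 1 i r) j s, by simp [hij]⟩

theorem exists_surjective_zmod_prod_zmod_of_not_isCyclic {A : Type*} [CommGroup A] [Finite A]
    (hA : ¬IsCyclic A) :
    ∃ d : ℕ, 1 < d ∧ ∃ φ : A →* Multiplicative (ZMod d) × Multiplicative (ZMod d),
      Function.Surjective φ := by
  obtain ⟨ι, _, n, hn, ⟨e⟩⟩ := CommGroup.equiv_prod_multiplicative_zmod_of_finite A
  have hnot_coprime : ¬Pairwise (Function.onFun Nat.Coprime n) := fun h =>
    hA (e.isCyclic.mpr (isCyclic_pi_zmod_of_pairwise_coprime h))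
  obtain ⟨i, j, hij, hgcd⟩ : ∃ i j, i ≠ j ∧ (n i).gcd (n j) ≠ 1 := by
    simpa only [Pairwise, not_forall, exists_prop] using hnot_coprime
  let d := (n i).gcd (n j)
  have hd : 1 < d := by
    have := Nat.gcd_pos_of_pos_left (n j) (zero_lt_one.trans (hn i))
    omega
  let reduction (k : ι) (hk : d ∣ n k) : Multiplicative (ZMod (n k)) →* Multiplicative (ZMod d) :=
    (ZMod.castHom hk (ZMod d)).toAddMonoidHom.toMultiplicative
  have hreduction (k : ι) (hk : d ∣ n k) : Function.Surjective (reduction k hk) :=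
    ZMod.castHom_surjective hk
  let coordinates : (∀ k, Multiplicative (ZMod (n k))) →* _ :=
    (Pi.evalMonoidHom _ i).prod (Pi.evalMonoidHom _ j)
  have hcoordinates : Function.Surjective coordinates :=
    surjective_evalMonoidHom_prod_evalMonoidHom hij
  have hdi : d ∣ n i := Nat.gcd_dvd_left _ _
  have hdj : d ∣ n j := Nat.gcd_dvd_right _ _
  let reductions := (reduction i hdi).prodMap (reduction j hdj)
  have hreductions : Function.Surjective reductions := (hreduction i hdi).prodMap (hreduction j hdj)
  exact ⟨d, hd, (reductions.comp coordinates).comp e.toMonoidHom,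
    (hreductions.comp hcoordinates).comp e.surjective⟩

/-- The bimultiplicative map `(x, y) ↦ (φ x).1 * (φ y).2`, where the product is that of the ring
`R`; it takes values in the additive group of `R`, written multiplicatively and lifted to the
universe `v`. -/
def ringPairing {A R : Type*} [Group A] [Ring R] (φ : A →* Multiplicative R × Multiplicative R) :
    A →* A →* ULift.{v} (Multiplicative R) :=
  MonoidHom.mk'
    (fun x => MonoidHom.mk' (fun y => ⟨.ofAdd ((φ x).1.toAdd * (φ y).2.toAdd)⟩)
      fun y z => ULift.ext _ _ (by simp [mul_add]))
    fun x y => MonoidHom.ext fun z => ULift.ext _ _ (by simp [add_mul])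

theorem ringPairing_apply {A R : Type*} [Group A] [Ring R]
    (φ : A →* Multiplicative R × Multiplicative R) (x y : A) :
    ringPairing.{v} φ x y = ⟨.ofAdd ((φ x).1.toAdd * (φ y).2.toAdd)⟩ := rfl

theorem exists_ringPairing_div_eq {A R : Type*} [Group A] [Ring R]
    {φ : A →* Multiplicative R × Multiplicative R} (hφ : Function.Surjective φ)
    (m : ULift.{v} (Multiplicative R)) :
    ∃ x y, ringPairing φ x y / ringPairing φ y x = m := by
  obtain ⟨x, hx⟩ := hφ (m.down, 1)
  obtain ⟨y, hy⟩ := hφ (1, .ofAdd 1)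
  exact ⟨x, y, ULift.ext _ _ (by simp [ringPairing_apply, hx, hy])⟩

theorem exists_isStem_card_lt {G : Type u} [CommGroup G] [Finite G] (hG : ¬IsCyclic G) :
    ∃ (N E : Type v) (_ : Group N) (_ : Group E) (S : GroupExtension N E G),
      S.IsStem ∧ Nat.card G < Nat.card E := by
  let e : Shrink.{v} G ≃* G := Shrink.mulEquiv
  obtain ⟨d, hd, φ, hφ⟩ :=
    exists_surjective_zmod_prod_zmod_of_not_isCyclic (mt e.isCyclic.mp hG)
  let S := groupExtensionCongrRight (HeisenbergGroup.extension (ringPairing.{v} φ)) e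
  have hclosure : Subgroup.closure
      {m | ∃ x y, ringPairing.{v} φ x y / ringPairing φ y x = m} = ⊤ :=
    top_unique fun m _ => Subgroup.subset_closure (exists_ringPairing_div_eq hφ m)
  have hcard : Nat.card (HeisenbergGroup (ringPairing.{v} φ)) = Nat.card G * d := by
    rw [card_eq_card_mul_card_of_groupExtension S, Nat.card_ulift,
      Nat.card_congr Multiplicative.toAdd, Nat.card_zmod]
  refine ⟨_, _, _, _, S, (isStem_groupExtensionCongrRight_iff e).mpr
    (HeisenbergGroup.isStem_extension hclosure), ?_⟩
  rw [hcard]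
  exact lt_mul_of_one_lt_right Nat.card_pos hd

end NonCyclic

theorem isCyclic_of_isSchurCover {N E : Type v} {G : Type u} [Group N] [Group E] [Group G]
    [Finite G] {S : GroupExtension N E G} [IsMulCommutative E] (hS : S.IsSchurCover) :
    IsCyclic G := by
  have : IsMulCommutative G :=
    Function.Surjective.mul_comm (f := (S.rightHom : E →ₙ* G)) S.rightHom_surjective inferInstance
  let _ : CommGroup G := { mul_comm := mul_comm' }
  by_contra hG
  obtain ⟨N', E', _, _, S', hS', hlt⟩ := exists_isStem_card_lt.{u, v} hG
  have hcard : Nat.card E = Nat.card G :=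
    Nat.card_eq_of_bijective _ ⟨rightHom_injective_of_isStem hS.1, S.rightHom_surjective⟩
  have := finite_of_isStem hS.1
  have := finite_of_isStem hS'
  have hle := hS.2 N' E' S' hS'
  rw [ENat.card_eq_coe_natCard, ENat.card_eq_coe_natCard, Nat.cast_le, hcard] at hle
  exact hle.not_gt hlt

theorem mainTheorem1 (G : Type u) [Group G] [Finite G] :
    (∃ (N E : Type v) (_ : Group N) (_ : Group E) (S : GroupExtension N E G), S.IsSchurCover) ∧
    ∀ (N E : Type v) [Group N] [Group E] (S : GroupExtension N E G), S.IsSchurCover →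
      (S.deepCommutingGraph = ⊤ ↔ IsCyclic G) := by
  refine ⟨exists_isSchurCover G, fun N E _ _ S hS => ?_⟩
  have hcentral : S.IsCentral := hS.1.1
  rw [deepCommutingGraph_eq_top_iff_isMulCommutative hcentral]
  exact ⟨fun _ => isCyclic_of_isSchurCover hS, fun _ =>
    S.rightHom.isMulCommutative_of_isCyclic_of_ker_le_center (ker_rightHom_le_center hcentral)⟩
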